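/- Let $\mathcal X,\mathcal Y$ be finite alphabets, $P_{XY}$ a probability distribution on $\mathcal X\times\mathcal Y$ with marginal $P_X$, and $r\ge 0$ a real number; $\log$ is to base $2$. A classical state splitting protocol with $M$ messages for a distribution $P_{XY}$ consists of shared randomness $S$ (a random variable on an arbitrary probability space, available to Alice and Bob and independent of $(X,Y)$), a randomized encoder $e(m\mid x,s)$ by which Alice, who observes $x$ and $s$, sends a message $m\in\{1,\dots,M\}$, and a randomized decoder $d(y\mid m,s)$ by which Bob, who observes $m$ and $s$, outputs $y\in\mathcal Y$. With $$P_{X\hat Y}(x,y)=P_X(x)\,\mathbb E_S\Big[\sum_{m=1}^M e(m\mid x,S)\,d(y\mid m,S)\Big]$$ its error is the trace distance $\frac12\sum_{x,y}|P_{XY}(x,y)-P_{X\hat Y}(x,y)|$. Let $R(P_{XY},\epsilon)$ be the infimum of $\log M$ over all $M$ and all protocols with $M$ messages and error at most $\epsilon$, and let $$\epsilon(P_{XY},\lambda)=\inf\{\epsilon\in[0,1] : R(P_{XY},\epsilon)\le\lambda\}.$$ For $\alpha\in[0,1)$, a probability distribution $p$ and a nonnegative function $q$ on a finite set, let $D_\alpha(p\|q)=\frac1{\alpha-1}\log\sum_{\omega:\,p(\omega)>0}p(\omega)^\alpha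 q(\omega)^{1-\alpha}$ if the supports of $p$ and $q$ intersect and $D_\alpha(p\|q)=+\infty$ otherwise; let $D_1(p\|q)=\sum_{\omega}p(\omega)\log\frac{p(\omega)}{q(\omega)}$ if the support of $p$ is contained in that of $q$ and $D_1(p\|q)=+\infty$ otherwise. Let $$I_\alpha(X:Y)_P=\inf_{q_Y}D_\alpha(P_{XY}\,\|\,P_X\otimes q_Y),$$ the infimum being over all probability distributions $q_Y$ on $\mathcal Y$. **Theorem.** For every such $P_{XY}$ and every $r\ge0$, the strong converse exponent of classical state splitting exists and is given by $$\lim_{n\to\infty}\frac{-1}{n}\log\bigl(1-\epsilon(P_{XY}^{\otimes n},nr)\bigr)=\sup_{0\le\alpha\le1}(1-\alpha)\bigl\{I_\alpha(X:Y)_P-r\bigr\}.$$ -/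

import Mathlib

open scoped Topology

noncomputable section

namespace ClassicalSplitting

open MeasureTheory

/-- The marginal on the first component of a function on a product alphabet. -/
def marginalFst {X Y : Type*} [Fintype Y] (P : X × Y → ℝ) (x : X) : ℝ :=
  ∑ y, P (x, y)

/-- The `n`-fold i.i.d. extension `P_{XY}^{⊗ n}`, on pairs of words of length `n`. -/
def iid {X Y : Type*} (P : X × Y → ℝ) (n : ℕ) (z : (Fin n → X) × (Fin n → Y)) : ℝ :=
  ∏ i, P (z.1 i, z.2 i)

/-- The trace distance `½ ‖p - q‖₁` of two distributions on a finite alphabet. -/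
def traceDist {Ω : Type*} [Fintype Ω] (p q : Ω → ℝ) : ℝ :=
  (1 / 2) * ∑ ω, |p ω - q ω|

/-- A protocol in which Alice, who holds a symbol of `X`, sends one of `M` messages to Bob, who
outputs a symbol of `Y`. The shared randomness is a random variable `s` of law `μ` on an arbitrary
probability space; it is independent of Alice's input. Given `s` and the input `x`, Alice sends `m`
with probability `enc s x m`; given `s` and the message `m`, Bob outputs `y` with probability
`dec s m y`. (The randomness of `enc` and of `dec` is local to Alice and to Bob.) -/
structure Protocol (X Y : Type*) [Fintype Y] (M : ℕ) where
  /-- values of the shared randomness -/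
  S : Type
  [measurableSpace : MeasurableSpace S]
  /-- law of the shared randomness -/
  μ : Measure S
  [isProbabilityMeasure : IsProbabilityMeasure μ]
  /-- Alice's randomized encoder -/
  enc : S → X → Fin M → ℝ
  enc_mem : ∀ s x, enc s x ∈ stdSimplex ℝ (Fin M)
  enc_measurable : ∀ x m, Measurable fun s => enc s x m
  /-- Bob's randomized decoder -/
  dec : S → Fin M → Y → ℝ
  dec_mem : ∀ s m, dec s m ∈ stdSimplex ℝ Y
  dec_measurable : ∀ m y, Measurable fun s => dec s m y

attribute [instance] Protocol.measurableSpace Protocol.isProbabilityMeasure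

/-- The conditional probability that Bob outputs `y` when Alice's input is `x`. -/
def Protocol.channel {X Y : Type*} [Fintype Y] {M : ℕ} (π : Protocol X Y M) (x : X) (y : Y) : ℝ :=
  ∫ s, ∑ m, π.enc s x m * π.dec s m y ∂π.μ

/-- The joint distribution `P_{X Ŷ}` of Alice's input and Bob's output. -/
def Protocol.joint {X Y : Type*} [Fintype Y] {M : ℕ} (π : Protocol X Y M) (P : X × Y → ℝ)
    (z : X × Y) : ℝ :=
  marginalFst P z.1 * π.channel z.1 z.2

/-- The error of a protocol: the trace distance between `P_{XY}` and `P_{X Ŷ}`. -/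
def Protocol.error {X Y : Type*} [Fintype X] [Fintype Y] {M : ℕ} (π : Protocol X Y M)
    (P : X × Y → ℝ) : ℝ :=
  traceDist P (π.joint P)

/-- `R(P_{XY}, ε)`: the minimal number of bits, `log₂ M`, that a protocol with error at most `ε`
communicates. -/
def commCost {X Y : Type*} [Fintype X] [Fintype Y] (P : X × Y → ℝ) (ε : ℝ) : ℝ :=
  sInf {b : ℝ | ∃ (M : ℕ) (π : Protocol X Y M), π.error P ≤ ε ∧ b = Real.logb 2 M}

/-- `ε(P_{XY}, l)`: the optimal error with at most `l` bits of communication. -/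
def optError {X Y : Type*} [Fintype X] [Fintype Y] (P : X × Y → ℝ) (l : ℝ) : ℝ :=
  sInf {ε : ℝ | ε ∈ Set.Icc (0 : ℝ) 1 ∧ commCost P ε ≤ l}

open Classical in
/-- The Rényi divergence `D_α(p ‖ q)` in bits, for `α ≥ 0`, of a probability distribution `p` and a
nonnegative function `q`; it is the relative entropy for `α = 1`. The sum runs over the support of
`p`, which matters only for `α = 0`, where `p ^ 0` is the indicator of the support. -/
def renyiDiv {Ω : Type*} [Fintype Ω] (α : ℝ) (p q : Ω → ℝ) : EReal :=
  if α = 1 then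
    if ∀ ω, q ω = 0 → p ω = 0 then
      ((∑ ω, p ω * Real.logb 2 (p ω / q ω) : ℝ) : EReal)
    else ⊤
  else if (α < 1 ∧ ∃ ω, p ω ≠ 0 ∧ q ω ≠ 0) ∨ (1 < α ∧ ∀ ω, q ω = 0 → p ω = 0) then
    ((1 / (α - 1) * Real.logb 2 (∑ ω with p ω ≠ 0, p ω ^ α * q ω ^ (1 - α)) : ℝ) : EReal)
  else ⊤

/-- The Rényi mutual information `I_α(X : Y) = inf_{q_Y} D_α(P_{XY} ‖ P_X ⊗ q_Y)`, in bits. -/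
def renyiMutualInfo {X Y : Type*} [Fintype X] [Fintype Y] (α : ℝ) (P : X × Y → ℝ) : EReal :=
  ⨅ q ∈ stdSimplex ℝ Y, renyiDiv α P (fun z => marginalFst P z.1 * q z.2)

end ClassicalSplitting

end

/-!
Write `overlap P c q = ∑ min(P_{XY}, c · P_X ⊗ q)`, so that `1 - ½ ‖P - P'‖₁ = ∑ min(P, P')` turns the
success probability `1 - ε` into an overlap.

*One shot.* A channel simulated with `M` messages is dominated by `M · q`, where `q` is Bob's output
distribution for a uniform message (`Protocol.exists_one_sub_error_le`). Conversely, rejection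
sampling from `M` shared samples of `q` simulates half of every subchannel dominated by `M · q`
(`exists_protocol_overlap_le`). Hence `1 - ε(P, l)` equals `max_q overlap P (2 ^ l) q` up to a factor
of `4`, and only the exponent of this maximum for `P^{⊗ n}` and `l = n r` matters.

*Lower bound on the exponent.* From `min(a, b) ≤ a ^ α * b ^ (1 - α)`, the overlap is at most
`2 ^ (n r (1 - α))` times an `α`-affinity of `P^{⊗ n}` and `P_X^{⊗ n} ⊗ q`. The maximum over `q` of
the affinity, which is `2 ^ (-(1 - α) I_α)`, is submultiplicative (`sum_prod_mul_rpow_le`).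

*Upper bound on the exponent.* If `e` exceeds the supremum, then for each `α ∈ (0, 1)` some `q` makes
the affinity `∑ P ^ α (2 ^ r P_X ⊗ q) ^ (1 - α)` exceed `2 ^ (-e)`. The affinity is convex in `α` and
concave in `q`, so a minimax argument gives one `q` that works for all `α`
(`exists_forall_le_affinity_prod`). With the product distribution `q^{⊗ n}`, the overlap is the one
in Chernoff's theorem on symmetric hypothesis testing, and the lower bound of that theorem,
`exists_pow_mul_exp_le_sum_min`, applies.
-/

namespace ClassicalSplitting

open MeasureTheory Finset Filter

/-! ### One-shot bounds -/

/-- The overlap `1 - ½ ‖p - q‖₁` of two distributions. -/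
lemma one_sub_traceDist_eq_sum_min {Ω : Type*} [Fintype Ω] {p q : Ω → ℝ}
    (hp : ∑ ω, p ω = 1) (hq : ∑ ω, q ω = 1) :
    1 - traceDist p q = ∑ ω, min (p ω) (q ω) := by
  have h : ∀ ω, min (p ω) (q ω) = (1 / 2) * (p ω + q ω - |p ω - q ω|) := fun ω => by
    rw [min_def]
    split_ifs with h
    · rw [abs_of_nonpos (sub_nonpos.2 h)]
      ring
    · rw [abs_of_nonneg (sub_nonneg.2 (not_le.1 h).le)]
      ring
  simp_rw [h, traceDist, ← mul_sum, sum_sub_distrib, sum_add_distrib, hp, hq]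
  ring

/-- The overlap `∑ min(P_{XY}, c · P_X ⊗ q)`. -/
noncomputable def overlap {X Y : Type*} [Fintype X] [Fintype Y] (P : X × Y → ℝ) (c : ℝ)
    (q : Y → ℝ) : ℝ :=
  ∑ z, min (P z) (c * (marginalFst P z.1 * q z.2))

section OneShot

variable {X Y : Type*} [Fintype Y] {P : X × Y → ℝ}

lemma marginalFst_nonneg [Fintype X] (hP : P ∈ stdSimplex ℝ (X × Y)) (x : X) :
    0 ≤ marginalFst P x :=
  sum_nonneg fun _ _ => hP.1 _

lemma le_marginalFst [Fintype X] (hP : P ∈ stdSimplex ℝ (X × Y)) (z : X × Y) :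
    P z ≤ marginalFst P z.1 :=
  single_le_sum (f := fun y => P (z.1, y)) (fun _ _ => hP.1 _) (mem_univ z.2)

lemma sum_marginalFst [Fintype X] (hP : P ∈ stdSimplex ℝ (X × Y)) : ∑ x, marginalFst P x = 1 := by
  rw [← hP.2, Fintype.sum_prod_type]
  rfl

lemma overlap_mono [Fintype X] (hP : P ∈ stdSimplex ℝ (X × Y)) {q : Y → ℝ} (hq : q ∈ stdSimplex ℝ Y)
    {c d : ℝ} (hcd : c ≤ d) : overlap P c q ≤ overlap P d q := by
  unfold overlap
  gcongr with z
  exact mul_nonneg (marginalFst_nonneg hP _) (hq.1 _)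

lemma Protocol.integrable {M : ℕ} (π : Protocol X Y M) (x : X) (m : Fin M) (y : Y) :
    Integrable (fun s => π.enc s x m * π.dec s m y) π.μ := by
  refine Integrable.of_bound (C := 1)
    ((π.enc_measurable x m).mul (π.dec_measurable m y)).aestronglyMeasurable
    (ae_of_all _ fun s => ?_)
  have h1 := mem_Icc_of_mem_stdSimplex (π.enc_mem s x) m
  have h2 := mem_Icc_of_mem_stdSimplex (π.dec_mem s m) y
  rw [Real.norm_of_nonneg (mul_nonneg h1.1 h2.1)]
  exact mul_le_one₀ h1.2 h2.1 h2.2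

lemma Protocol.integrable_dec {M : ℕ} (π : Protocol X Y M) (m : Fin M) (y : Y) :
    Integrable (fun s => π.dec s m y) π.μ := by
  refine Integrable.of_bound (C := 1)
    (π.dec_measurable m y).aestronglyMeasurable
    (ae_of_all _ fun s => ?_)
  have h2 := mem_Icc_of_mem_stdSimplex (π.dec_mem s m) y
  rw [Real.norm_of_nonneg h2.1]
  exact h2.2

lemma Protocol.sum_channel {M : ℕ} (π : Protocol X Y M) (x : X) : ∑ y, π.channel x y = 1 := by
  unfold Protocol.channel
  rw [← integral_finsetSum _ fun y _ => integrable_finsetSum _ fun m _ => π.integrable x m y]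
  have : ∀ s, ∑ y, ∑ m, π.enc s x m * π.dec s m y = 1 := fun s => by
    rw [sum_comm]
    simp_rw [← mul_sum, (π.dec_mem s _).2, mul_one, (π.enc_mem s x).2]
  simp [this]

lemma Protocol.sum_joint [Fintype X] {M : ℕ} (π : Protocol X Y M) (hP : P ∈ stdSimplex ℝ (X × Y)) :
    ∑ z, π.joint P z = 1 := by
  simp_rw [Protocol.joint, Fintype.sum_prod_type, ← mul_sum, π.sum_channel, mul_one]
  exact sum_marginalFst hP

lemma Protocol.channel_nonneg {M : ℕ} (π : Protocol X Y M) (x : X) (y : Y) :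
    0 ≤ π.channel x y :=
  integral_nonneg fun s => sum_nonneg fun m _ =>
    mul_nonneg ((π.enc_mem s x).1 m) ((π.dec_mem s m).1 y)

lemma Protocol.one_sub_error [Fintype X] {M : ℕ} (π : Protocol X Y M) (hP : P ∈ stdSimplex ℝ (X × Y)) :
    1 - π.error P = ∑ z, min (P z) (π.joint P z) :=
  one_sub_traceDist_eq_sum_min hP.2 (π.sum_joint hP)

lemma Protocol.pos {M : ℕ} (π : Protocol X Y M) (x : X) : 0 < M := by
  obtain ⟨s⟩ : Nonempty π.S := π.μ.nonempty_of_neZero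
  rcases Nat.eq_zero_or_pos M with rfl | h
  · simpa using (π.enc_mem s x).2
  · exact h

/-- Bob's output distribution, averaged over a uniform message, dominates the simulated channel
up to the factor `M`. -/
lemma Protocol.exists_one_sub_error_le [Fintype X] [Nonempty X] {M : ℕ} (π : Protocol X Y M)
    (hP : P ∈ stdSimplex ℝ (X × Y)) :
    ∃ q ∈ stdSimplex ℝ Y, 1 - π.error P ≤ overlap P M q := by
  have hM : (0 : ℝ) < M := Nat.cast_pos.2 (π.pos (Classical.arbitrary X))
  refine ⟨fun y => (M : ℝ)⁻¹ * ∫ s, ∑ m, π.dec s m y ∂π.μ, ⟨fun y => ?_, ?_⟩, ?_⟩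
  · exact mul_nonneg (inv_nonneg.2 hM.le)
      (integral_nonneg fun s => sum_nonneg fun m _ => (π.dec_mem s m).1 y)
  · rw [← mul_sum, ← integral_finsetSum _ fun y _ => integrable_finsetSum _ fun m _ =>
      π.integrable_dec m y]
    have : ∀ s, ∑ y, ∑ m, π.dec s m y = M := fun s => by
      rw [sum_comm]
      simp [(π.dec_mem s _).2]
    simp [this, hM.ne']
  · rw [π.one_sub_error hP, overlap]
    refine sum_le_sum fun z _ => min_le_min_left _ ?_
    have : π.channel z.1 z.2 ≤ ∫ s, ∑ m, π.dec s m z.2 ∂π.μ := by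
      refine integral_mono (integrable_finsetSum _ fun m _ => π.integrable _ m _)
        (integrable_finsetSum _ fun m _ => π.integrable_dec m _) fun s => ?_
      refine sum_le_sum fun m _ => ?_
      exact mul_le_of_le_one_left ((π.dec_mem s m).1 _)
        (mem_Icc_of_mem_stdSimplex (π.enc_mem s z.1) m).2
    calc marginalFst P z.1 * π.channel z.1 z.2
        ≤ marginalFst P z.1 * ∫ s, ∑ m, π.dec s m z.2 ∂π.μ :=
          mul_le_mul_of_nonneg_left this (marginalFst_nonneg hP _)
      _ = _ := by field_simp

/-- The protocol whose shared randomness takes finitely many values, with probabilities `w`. -/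
noncomputable def Protocol.ofFinite {M : ℕ} {T : Type} [Fintype T] (w : T → ℝ) (hw : w ∈ stdSimplex ℝ T)
    (enc : T → X → Fin M → ℝ) (enc_mem : ∀ s x, enc s x ∈ stdSimplex ℝ (Fin M))
    (dec : T → Fin M → Y → ℝ) (dec_mem : ∀ s m, dec s m ∈ stdSimplex ℝ Y) :
    Protocol X Y M :=
  letI : MeasurableSpace T := ⊤
  { S := T
    μ := ∑ s, ENNReal.ofReal (w s) • Measure.dirac s
    isProbabilityMeasure := ⟨by
      simp only [Measure.coe_finsetSum, Finset.sum_apply, Measure.smul_apply, measure_univ,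
        smul_eq_mul, mul_one]
      rw [← ENNReal.ofReal_sum_of_nonneg fun s _ => hw.1 s, hw.2, ENNReal.ofReal_one]⟩
    enc := enc
    enc_mem := enc_mem
    enc_measurable := fun _ _ => measurable_from_top
    dec := dec
    dec_mem := dec_mem
    dec_measurable := fun _ _ => measurable_from_top }

lemma Protocol.channel_ofFinite {M : ℕ} {T : Type} [Fintype T] {w : T → ℝ}
    (hw : w ∈ stdSimplex ℝ T)
    {enc : T → X → Fin M → ℝ} (enc_mem : ∀ s x, enc s x ∈ stdSimplex ℝ (Fin M))
    {dec : T → Fin M → Y → ℝ} (dec_mem : ∀ s m, dec s m ∈ stdSimplex ℝ Y) (x : X) (y : Y) :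
    (Protocol.ofFinite w hw enc enc_mem dec dec_mem).channel x y =
      ∑ s, w s * ∑ m, enc s x m * dec s m y := by
  let _ : MeasurableSpace T := ⊤
  change ∫ s, ∑ m, enc s x m * dec s m y ∂(∑ s, ENNReal.ofReal (w s) • Measure.dirac s) = _
  rw [integral_finsetSum_measure]
  · refine sum_congr rfl fun s _ => ?_
    rw [integral_smul_measure, integral_dirac, ENNReal.toReal_ofReal (hw.1 s), smul_eq_mul]
  · intro s _
    exact (integrable_dirac (by simp)).smul_measure ENNReal.ofReal_ne_top

end OneShot

/-! ### One-shot simulation by rejection sampling -/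

/-- Under the product weights `q ⊗ ⋯ ⊗ q`, a function of one coordinate. -/
lemma sum_prod_mul_apply {T : Type*} [Fintype T] {q : T → ℝ} (hq : ∑ t, q t = 1)
    {M : ℕ} (m : Fin M) (f : T → ℝ) :
    ∑ s : Fin M → T, (∏ i, q (s i)) * f (s m) = ∑ t, q t * f t := by
  classical
  have h : ∀ s : Fin M → T, (∏ i, q (s i)) * f (s m) =
      ∏ i, q (s i) * (if i = m then f (s i) else 1) := fun s => by
    rw [prod_mul_distrib, prod_ite_eq' univ m fun i => f (s i)]
    simp
  simp_rw [h]
  rw [← Fintype.prod_sum fun i t => q t * (if i = m then f t else 1),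
    Fintype.prod_eq_single m fun i hi => by simp [hi, hq]]
  simp

/-- Distinct coordinates are independent under the product weights `q ⊗ ⋯ ⊗ q`. -/
lemma sum_prod_mul_apply_mul_apply {T : Type*} [Fintype T] {q : T → ℝ} (hq : ∑ t, q t = 1)
    {M : ℕ} {m m' : Fin M} (hm : m ≠ m') (f g : T → ℝ) :
    ∑ s : Fin M → T, (∏ i, q (s i)) * (f (s m) * g (s m')) =
      (∑ t, q t * f t) * ∑ t, q t * g t := by
  classical
  have h : ∀ s : Fin M → T, (∏ i, q (s i)) * (f (s m) * g (s m')) =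
      ∏ i, q (s i) * ((if i = m then f (s i) else 1) * (if i = m' then g (s i) else 1)) :=
    fun s => by
      rw [prod_mul_distrib, prod_mul_distrib, prod_ite_eq' univ m fun i => f (s i),
        prod_ite_eq' univ m' fun i => g (s i)]
      simp
  simp_rw [h]
  rw [← Fintype.prod_sum fun i t =>
      q t * ((if i = m then f t else 1) * (if i = m' then g t else 1)),
    Fintype.prod_eq_mul m m' hm fun i hi => by simp [hi.1, hi.2, hq]]
  simp [hm, hm.symm]

/-- The probability vector proportional to `a`, or the uniform one if `a` vanishes. -/
noncomputable def normalize {M : ℕ} (a : Fin M → ℝ) (m : Fin M) : ℝ :=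
  if ∑ i, a i = 0 then (M : ℝ)⁻¹ else a m / ∑ i, a i

lemma normalize_mem {M : ℕ} (hM : 0 < M) {a : Fin M → ℝ} (ha : ∀ i, 0 ≤ a i) :
    normalize a ∈ stdSimplex ℝ (Fin M) := by
  have hM' : (M : ℝ) ≠ 0 := by positivity
  unfold normalize
  split_ifs with h
  · exact ⟨fun _ => by positivity, by simp [hM']⟩
  · refine ⟨fun m => div_nonneg (ha m) (sum_nonneg fun i _ => ha i), ?_⟩
    rw [← sum_div, div_self h]

/-- The tangent to `t ↦ 1 / (1 + t)` at `t = 1` bounds the normalized weight from below by a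
polynomial, whose expectation only involves pairs of coordinates. -/
lemma le_normalize {M : ℕ} {a : Fin M → ℝ} (ha : ∀ i, 0 ≤ a i) (ha' : ∀ i, a i ≤ 1) (m : Fin M) :
    a m * ((3 - ∑ i ∈ univ.erase m, a i) / 4) ≤ normalize a m := by
  have hs : ∑ i, a i = a m + ∑ i ∈ univ.erase m, a i := (add_sum_erase _ _ (mem_univ m)).symm
  have h0 : 0 ≤ ∑ i ∈ univ.erase m, a i := sum_nonneg fun i _ => ha i
  unfold normalize
  rw [hs]
  set A := ∑ i ∈ univ.erase m, a i
  have h1 := ha m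
  have h2 := ha' m
  split_ifs with h
  · have : a m = 0 := by linarith
    rw [this, zero_mul]
    positivity
  · have hpos : 0 < a m + A := lt_of_le_of_ne (by linarith) (Ne.symm h)
    rw [div_eq_mul_one_div (a m) (a m + A)]
    refine mul_le_mul_of_nonneg_left ?_ h1
    rw [div_le_div_iff₀ (by norm_num) hpos]
    rcases le_total A 3 with hA | hA
    · nlinarith [sq_nonneg (A - 1), mul_le_mul_of_nonneg_left h2 (sub_nonneg.2 hA)]
    · nlinarith [mul_nonneg (sub_nonneg.2 hA) hpos.le]

/-- Among `M` samples from `q`, accepted with weights `a` of mean at most `1 / M`, the selected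
sample has at least half of the sub-distribution `M · q · a`. -/
lemma half_le_sum_normalize {T : Type*} [Fintype T] {q a b : T → ℝ} (hq : q ∈ stdSimplex ℝ T)
    {M : ℕ} (ha : ∀ t, 0 ≤ a t) (ha' : ∀ t, a t ≤ 1) (hb : ∀ t, 0 ≤ b t)
    (hqa : M * ∑ t, q t * a t ≤ 1) :
    (M / 2) * ∑ t, q t * (a t * b t) ≤
      ∑ s : Fin M → T, (∏ i, q (s i)) * ∑ m, normalize (fun i => a (s i)) m * b (s m) := by
  classical
  set B := ∑ t, q t * (a t * b t)
  set A := ∑ t, q t * a t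
  have hB : 0 ≤ B := sum_nonneg fun t _ => mul_nonneg (hq.1 t) (mul_nonneg (ha t) (hb t))
  have hA : 0 ≤ A := sum_nonneg fun t _ => mul_nonneg (hq.1 t) (ha t)
  have key : ∀ m : Fin M, B / 2 ≤
      ∑ s : Fin M → T, (∏ i, q (s i)) * (normalize (fun i => a (s i)) m * b (s m)) := by
    intro m
    have h1 : ∑ s : Fin M → T, (∏ i, q (s i)) *
          ((a (s m) * ((3 - ∑ i ∈ univ.erase m, a (s i)) / 4)) * b (s m)) =
        B * (3 / 4) - (∑ i ∈ univ.erase m, B * A) / 4 := by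
      have h2 : ∀ s : Fin M → T, (∏ i, q (s i)) *
          ((a (s m) * ((3 - ∑ i ∈ univ.erase m, a (s i)) / 4)) * b (s m)) =
          ((∏ i, q (s i)) * (a (s m) * b (s m))) * (3 / 4) -
          (∑ j ∈ univ.erase m, (∏ i, q (s i)) * ((a (s m) * b (s m)) * a (s j))) / 4 :=
        fun s => by
          rw [← mul_sum, ← mul_sum]
          ring
      simp_rw [h2]
      rw [sum_sub_distrib, ← sum_mul, ← sum_div, sum_comm,
        sum_prod_mul_apply hq.2 m fun t => a t * b t]
      congr 2
      refine sum_congr rfl fun j hj => ?_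
      exact sum_prod_mul_apply_mul_apply hq.2 (ne_of_mem_erase hj).symm (fun t => a t * b t) a
    have h3 : ∑ i ∈ univ.erase m, B * A ≤ B := by
      rw [sum_const, nsmul_eq_mul]
      have : ((univ.erase m).card : ℝ) ≤ M := by
        exact_mod_cast (card_le_univ _).trans_eq (Fintype.card_fin M)
      nlinarith [mul_le_mul_of_nonneg_right this hA]
    calc B / 2 ≤ B * (3 / 4) - (∑ i ∈ univ.erase m, B * A) / 4 := by linarith
      _ ≤ _ := by
        rw [← h1]
        refine sum_le_sum fun s _ => mul_le_mul_of_nonneg_left ?_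
          (prod_nonneg fun i _ => hq.1 _)
        exact mul_le_mul_of_nonneg_right
          (le_normalize (fun i => ha (s i)) (fun i => ha' (s i)) m) (hb _)
  simp_rw [mul_sum]
  rw [sum_comm]
  calc (M / 2) * B = ∑ m : Fin M, B / 2 := by
        rw [sum_const, card_univ, Fintype.card_fin, nsmul_eq_mul]
        ring
    _ ≤ _ := sum_le_sum fun m _ => key m

lemma prod_mem_stdSimplex {T : Type*} [Fintype T] {q : T → ℝ} (hq : q ∈ stdSimplex ℝ T) (M : ℕ) :
    (fun s : Fin M → T => ∏ i, q (s i)) ∈ stdSimplex ℝ (Fin M → T) :=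
  ⟨fun s => prod_nonneg fun i _ => hq.1 _, by
    rw [← Fintype.prod_sum fun _ t => q t]
    simp [hq.2]⟩

section

variable {X Y : Type*} [Fintype X] [Fintype Y] {P : X × Y → ℝ}

/-- The two parties share `M` independent samples from `q`; Alice selects the index of one of them
with weights `min(1, P(x, y) / (M P_X(x) q(y)))`. -/
lemma exists_protocol_overlap_le (hP : P ∈ stdSimplex ℝ (X × Y)) {q : Y → ℝ}
    (hq : q ∈ stdSimplex ℝ Y) {M : ℕ} (hM : 0 < M) :
    ∃ π : Protocol X Y M, overlap P M q / 2 ≤ 1 - π.error P := by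
  classical
  -- The shared randomness must live in `Type`, so `Y` is replaced by `Fin (card Y)`.
  let e := (Fintype.equivFin Y).symm
  have hM' : (0 : ℝ) < M := Nat.cast_pos.2 hM
  have hqe : (fun t => q (e t)) ∈ stdSimplex ℝ (Fin (Fintype.card Y)) :=
    ⟨fun t => hq.1 _, by rw [Equiv.sum_comp e q, hq.2]⟩
  let a : X → Y → ℝ := fun x y => min 1 (P (x, y) / (M * (marginalFst P x * q y)))
  have hden : ∀ x y, 0 ≤ M * (marginalFst P x * q y) := fun x y =>
    mul_nonneg hM'.le (mul_nonneg (marginalFst_nonneg hP x) (hq.1 y))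
  have ha : ∀ x y, 0 ≤ a x y := fun x y => le_min zero_le_one (div_nonneg (hP.1 _) (hden x y))
  have ha' : ∀ x y, a x y ≤ 1 := fun x y => min_le_left _ _
  -- Both sides vanish when the denominator does.
  have hmul : ∀ x y, marginalFst P x * (M * (q y * a x y)) =
      min (P (x, y)) (M * (marginalFst P x * q y)) := fun x y => by
    rcases (hden x y).eq_or_lt with h | h
    · rw [← h, min_eq_right (hP.1 _)]
      calc _ = M * (marginalFst P x * q y) * a x y := by ring
        _ = 0 := by rw [← h, zero_mul]
    · calc _ = M * (marginalFst P x * q y) * a x y := by ring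
        _ = _ := by
          rw [mul_min_of_nonneg _ _ h.le, mul_div_cancel₀ _ h.ne', mul_one, min_comm]
  have hmean : ∀ x, M * ∑ y, q y * a x y ≤ 1 := fun x => by
    rcases (marginalFst_nonneg hP x).eq_or_lt with h | h
    · have : ∀ y, a x y = 0 := fun y => by simp [a, ← h]
      simp [this]
    · refine le_of_mul_le_mul_left ?_ h
      rw [mul_one, mul_sum, mul_sum]
      simp_rw [hmul]
      exact sum_le_sum fun y _ => min_le_left _ _
  let π : Protocol X Y M := Protocol.ofFinite (fun s : Fin M → Fin (Fintype.card Y) =>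
      ∏ i, q (e (s i))) (prod_mem_stdSimplex hqe M)
    (fun s x => normalize fun i => a x (e (s i))) (fun s x => normalize_mem hM fun i => ha x _)
    (fun s m => Pi.single (e (s m)) 1) (fun s m => single_mem_stdSimplex ℝ _)
  have hch : ∀ x y, M / 2 * (q y * a x y) ≤ π.channel x y := fun x y => by
    rw [Protocol.channel_ofFinite]
    have h := half_le_sum_normalize (a := fun t => a x (e t))
      (b := fun t => (Pi.single (e t) (1 : ℝ) : Y → ℝ) y) hqe (M := M) (fun t => ha x _)
      (fun t => ha' x _) (fun t => (single_mem_stdSimplex ℝ (e t)).1 y)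
      (by rw [Equiv.sum_comp e fun y => q y * a x y]; exact hmean x)
    refine le_trans (le_of_eq ?_) h
    rw [Equiv.sum_comp e fun y' => q y' * (a x y' * (Pi.single y' (1 : ℝ) : Y → ℝ) y)]
    simp [Pi.single_apply]
  refine ⟨π, ?_⟩
  rw [π.one_sub_error hP, overlap, sum_div]
  refine sum_le_sum fun z _ => ?_
  have hmin : 0 ≤ min (P z) (M * (marginalFst P z.1 * q z.2)) := le_min (hP.1 z) (hden _ _)
  refine le_min (by linarith [min_le_left (P z) (M * (marginalFst P z.1 * q z.2))]) ?_
  calc _ = marginalFst P z.1 * (M / 2 * (q z.2 * a z.1 z.2)) := by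
        rw [← hmul]
        ring
    _ ≤ _ := mul_le_mul_of_nonneg_left (hch _ _) (marginalFst_nonneg hP _)

end

/-! ### The optimal error and the overlap -/

section

variable {X Y : Type*} [Fintype X] [Fintype Y] {P : X × Y → ℝ}

lemma nonempty_of_mem_stdSimplex {T : Type*} [Fintype T] {p : T → ℝ} (hp : p ∈ stdSimplex ℝ T) :
    Nonempty T := by
  by_contra h
  rw [not_nonempty_iff] at h
  simpa using hp.2

/-- Alice sends her input. This is why `commCost` is never the infimum of the empty set. -/
lemma exists_protocol_error_eq_zero (hP : P ∈ stdSimplex ℝ (X × Y)) :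
    ∃ (M : ℕ) (π : Protocol X Y M), π.error P = 0 := by
  classical
  obtain ⟨-, y₀⟩ := nonempty_of_mem_stdSimplex hP
  let e := Fintype.equivFin X
  let d : X → Y → ℝ := fun x =>
    if marginalFst P x = 0 then Pi.single y₀ 1 else fun y => P (x, y) / marginalFst P x
  have hd : ∀ x, d x ∈ stdSimplex ℝ Y := fun x => by
    by_cases h : marginalFst P x = 0
    · simp only [d, if_pos h]
      exact single_mem_stdSimplex ℝ _
    · simp only [d, if_neg h]
      refine ⟨fun y => div_nonneg (hP.1 _) (marginalFst_nonneg hP x), ?_⟩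
      rw [← sum_div]
      exact div_self h
  let π : Protocol X Y (Fintype.card X) := Protocol.ofFinite (T := Unit) (fun _ => 1)
    ⟨fun _ => zero_le_one, by simp⟩ (fun _ x => Pi.single (e x) 1)
    (fun _ x => single_mem_stdSimplex ℝ _) (fun _ m => d (e.symm m)) (fun _ m => hd _)
  have hch : ∀ x y, π.channel x y = d x y := fun x y => by
    refine (Protocol.channel_ofFinite _ _ _ x y).trans ?_
    simp [Pi.single_apply]
  refine ⟨_, π, ?_⟩
  have hj : π.joint P = P := by
    ext ⟨x, y⟩
    rw [Protocol.joint, hch]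
    by_cases h : marginalFst P x = 0
    · rw [h, zero_mul]
      exact le_antisymm (hP.1 _) ((le_marginalFst hP (x, y)).trans_eq h)
    · simp only [d, if_neg h]
      exact mul_div_cancel₀ _ h
  simp [Protocol.error, hj, traceDist]

lemma Protocol.error_mem_Icc {M : ℕ} (π : Protocol X Y M) (hP : P ∈ stdSimplex ℝ (X × Y)) :
    π.error P ∈ Set.Icc (0 : ℝ) 1 := by
  refine ⟨mul_nonneg (by norm_num) (sum_nonneg fun _ _ => abs_nonneg _), ?_⟩
  have h : 0 ≤ 1 - π.error P := by
    rw [π.one_sub_error hP]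
    exact sum_nonneg fun z _ => le_min (hP.1 z)
      (mul_nonneg (marginalFst_nonneg hP _) (π.channel_nonneg _ _))
  linarith

/-- The infimum in `commCost` is attained. -/
lemma exists_protocol_of_commCost_le (hP : P ∈ stdSimplex ℝ (X × Y)) {ε l : ℝ} (hε : 0 ≤ ε)
    (h : commCost P ε ≤ l) :
    ∃ (M : ℕ) (π : Protocol X Y M), π.error P ≤ ε ∧ (M : ℝ) ≤ 2 ^ l := by
  classical
  obtain ⟨x₀, -⟩ := nonempty_of_mem_stdSimplex hP
  have hne : ∃ M, ∃ π : Protocol X Y M, π.error P ≤ ε := by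
    obtain ⟨M, π, hπ⟩ := exists_protocol_error_eq_zero hP
    exact ⟨M, π, hπ.trans_le hε⟩
  obtain ⟨π, hπ⟩ := Nat.find_spec hne
  have hpos : (0 : ℝ) < Nat.find hne := Nat.cast_pos.2 (π.pos x₀)
  refine ⟨_, π, hπ, ?_⟩
  rw [← Real.logb_le_iff_le_rpow one_lt_two hpos]
  refine h.trans' (le_csInf ⟨_, ⟨_, π, hπ, rfl⟩⟩ ?_)
  rintro _ ⟨M, π', hπ', rfl⟩
  exact Real.logb_le_logb_of_le one_lt_two hpos (Nat.cast_le.2 (Nat.find_min' hne ⟨π', hπ'⟩))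

lemma Protocol.commCost_le {M : ℕ} (π : Protocol X Y M) {ε : ℝ} (h : π.error P ≤ ε) :
    commCost P ε ≤ Real.logb 2 M := by
  refine csInf_le ⟨0, ?_⟩ ⟨M, π, h, rfl⟩
  rintro _ ⟨M, -, -, rfl⟩
  exact div_nonneg (Real.log_natCast_nonneg M) (Real.log_nonneg one_le_two)

lemma bddBelow_optError {l : ℝ} :
    BddBelow {ε : ℝ | ε ∈ Set.Icc (0 : ℝ) 1 ∧ commCost P ε ≤ l} :=
  ⟨0, fun _ h => h.1.1⟩

lemma Protocol.optError_le {M : ℕ} (π : Protocol X Y M) (hP : P ∈ stdSimplex ℝ (X × Y)) {l : ℝ}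
    (h : Real.logb 2 M ≤ l) : optError P l ≤ π.error P :=
  csInf_le bddBelow_optError ⟨π.error_mem_Icc hP, (π.commCost_le le_rfl).trans h⟩

lemma optError_nonneg {l : ℝ} : 0 ≤ optError P l :=
  Real.sInf_nonneg fun _ h => h.1.1

/-- One-shot achievability. -/
lemma overlap_div_four_le_one_sub_optError (hP : P ∈ stdSimplex ℝ (X × Y)) {l : ℝ} (hl : 0 ≤ l)
    {q : Y → ℝ} (hq : q ∈ stdSimplex ℝ Y) : overlap P (2 ^ l) q / 4 ≤ 1 - optError P l := by
  have h1 : (1 : ℝ) ≤ 2 ^ l := Real.one_le_rpow one_le_two hl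
  have hM : 0 < ⌊(2 : ℝ) ^ l⌋₊ := Nat.floor_pos.2 h1
  obtain ⟨π, hπ⟩ := exists_protocol_overlap_le hP hq hM
  have h2 : optError P l ≤ π.error P := π.optError_le hP <| by
    rw [Real.logb_le_iff_le_rpow one_lt_two (Nat.cast_pos.2 hM)]
    exact Nat.floor_le (by positivity)
  set M := ⌊(2 : ℝ) ^ l⌋₊
  -- Rounding `2 ^ l` down to an integer at most halves it.
  have h3 : (2 : ℝ) ^ l ≤ 2 * M := by
    have := Nat.lt_floor_add_one ((2 : ℝ) ^ l)
    have h4 : (1 : ℝ) ≤ M := Nat.one_le_cast.2 hM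
    linarith
  have h5 : overlap P (2 * M) q ≤ 2 * overlap P M q := by
    rw [overlap, overlap, mul_sum]
    refine sum_le_sum fun z _ => ?_
    rw [mul_min_of_nonneg _ _ zero_le_two, mul_assoc]
    exact min_le_min_right _ (by linarith [hP.1 z])
  linarith [overlap_mono hP hq h3]

/-- One-shot converse. -/
lemma one_sub_optError_le (hP : P ∈ stdSimplex ℝ (X × Y)) {l : ℝ} (hl : 0 ≤ l) {B : ℝ}
    (hB : ∀ q ∈ stdSimplex ℝ Y, overlap P (2 ^ l) q ≤ B) : 1 - optError P l ≤ B := by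
  classical
  obtain ⟨x₀, y₀⟩ := nonempty_of_mem_stdSimplex hP
  have : Nonempty X := ⟨x₀⟩
  suffices 1 - B ≤ optError P l by linarith
  refine le_csInf ?_ ?_
  · obtain ⟨π, -⟩ := exists_protocol_overlap_le hP (single_mem_stdSimplex ℝ y₀) one_pos
    exact ⟨_, π.error_mem_Icc hP, (π.commCost_le le_rfl).trans (by simpa using hl)⟩
  · rintro ε ⟨hε, hε'⟩
    obtain ⟨M, π, hπ, hM⟩ := exists_protocol_of_commCost_le hP hε.1 hε'
    obtain ⟨q, hq, h⟩ := π.exists_one_sub_error_le hP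
    linarith [hB q hq, overlap_mono hP hq hM]

end

/-! ### Converse -/

lemma min_le_rpow_mul_rpow {a b α : ℝ} (ha : 0 ≤ a) (hb : 0 ≤ b) (hα : α ∈ Set.Icc (0 : ℝ) 1) :
    min a b ≤ a ^ α * b ^ (1 - α) := by
  rcases (le_min ha hb).eq_or_lt with h | h
  · rw [← h]
    positivity
  · calc min a b = min a b ^ α * min a b ^ (1 - α) := by
          rw [← Real.rpow_add h, add_sub_cancel, Real.rpow_one]
      _ ≤ _ := by
        gcongr
        · exact hα.1
        · exact min_le_left _ _
        · linarith [hα.2]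
        · exact min_le_right _ _

lemma sum_fin_succ_fun {T : Type*} [Fintype T] {n : ℕ} (f : (Fin (n + 1) → T) → ℝ) :
    ∑ w, f w = ∑ t, ∑ w : Fin n → T, f (Fin.cons t w) := by
  rw [← Fintype.sum_prod_type' fun t (w : Fin n → T) => f (Fin.cons t w)]
  exact (Equiv.sum_comp (Fin.consEquiv fun _ => T) f).symm

/-- Both sides are homogeneous of degree `β` in `q`. -/
lemma sum_mul_rpow_le_of_stdSimplex {T : Type*} [Fintype T] {c : T → ℝ} {β A : ℝ} (hβ : 0 < β)
    (h : ∀ q ∈ stdSimplex ℝ T, ∑ t, c t * q t ^ β ≤ A) {q : T → ℝ} (hq : ∀ t, 0 ≤ q t) :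
    ∑ t, c t * q t ^ β ≤ A * (∑ t, q t) ^ β := by
  rcases (sum_nonneg fun t (_ : t ∈ univ) => hq t).eq_or_lt with h0 | h0
  · have : ∀ t, q t = 0 := fun t =>
      (sum_eq_zero_iff_of_nonneg fun t _ => hq t).1 h0.symm t (mem_univ t)
    simp [this, Real.zero_rpow hβ.ne']
  · have h1 := h (fun t => q t / ∑ t, q t)
      ⟨fun t => div_nonneg (hq t) h0.le, by rw [← sum_div, div_self h0.ne']⟩
    have h2 : ∀ t, c t * (q t / ∑ t, q t) ^ β = c t * q t ^ β / (∑ t, q t) ^ β := fun t => by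
      rw [Real.div_rpow (hq t) h0.le, mul_div_assoc]
    simp_rw [h2] at h1
    rwa [← sum_div, div_le_iff₀ (Real.rpow_pos_of_pos h0 _)] at h1

/-- The maximum of `∑ c q ^ β` over probability vectors `q` is submultiplicative under tensor
powers of `c`, as one sees by disintegrating `q` along the first letter. -/
lemma sum_prod_mul_rpow_le {T : Type*} [Fintype T] {c : T → ℝ} (hc : ∀ t, 0 ≤ c t) {β A : ℝ}
    (hβ : 0 < β) (hA : 0 ≤ A) (h : ∀ q ∈ stdSimplex ℝ T, ∑ t, c t * q t ^ β ≤ A) (n : ℕ)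
    {q : (Fin n → T) → ℝ} (hq : ∀ w, 0 ≤ q w) :
    ∑ w, (∏ i, c (w i)) * q w ^ β ≤ A ^ n * (∑ w, q w) ^ β := by
  induction n with
  | zero => simp
  | succ n ih =>
    rw [sum_fin_succ_fun, sum_fin_succ_fun q]
    simp_rw [Fin.prod_univ_succ, Fin.cons_zero, Fin.cons_succ, mul_assoc, ← mul_sum]
    calc ∑ t, c t * ∑ w : Fin n → T, (∏ i, c (w i)) * q (Fin.cons t w) ^ β
        ≤ ∑ t, c t * (A ^ n * (∑ w : Fin n → T, q (Fin.cons t w)) ^ β) :=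
          sum_le_sum fun t _ => mul_le_mul_of_nonneg_left (ih fun w => hq _) (hc t)
      _ = A ^ n * ∑ t, c t * (∑ w : Fin n → T, q (Fin.cons t w)) ^ β := by
          rw [mul_sum]
          exact sum_congr rfl fun t _ => by ring
      _ ≤ A ^ n * (A * (∑ t, ∑ w : Fin n → T, q (Fin.cons t w)) ^ β) :=
          mul_le_mul_of_nonneg_left
            (sum_mul_rpow_le_of_stdSimplex hβ h fun t => sum_nonneg fun w _ => hq _)
            (pow_nonneg hA n)
      _ = _ := by ring

lemma marginalFst_iid {X Y : Type*} [Fintype Y] (P : X × Y → ℝ) (n : ℕ) (x : Fin n → X) :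
    marginalFst (iid P n) x = ∏ i, marginalFst P (x i) := by
  classical
  exact (Fintype.prod_sum fun i y => P (x i, y)).symm

section

variable {X Y : Type*} [Fintype X] [Fintype Y] {P : X × Y → ℝ}

/-- Pairs of words as words of pairs. -/
lemma sum_words (n : ℕ) (f : (Fin n → X) × (Fin n → Y) → ℝ) :
    ∑ z, f z = ∑ w : Fin n → X × Y, f (fun i => (w i).1, fun i => (w i).2) :=
  (Equiv.sum_comp (Equiv.arrowProdEquivProdArrow (Fin n) (fun _ => X) fun _ => Y) f).symm

lemma iid_mem_stdSimplex (hP : P ∈ stdSimplex ℝ (X × Y)) (n : ℕ) :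
    iid P n ∈ stdSimplex ℝ ((Fin n → X) × (Fin n → Y)) :=
  ⟨fun _ => prod_nonneg fun _ _ => hP.1 _, by
    rw [sum_words]
    exact (prod_mem_stdSimplex hP n).2⟩

open Classical in
/-- The weight of the letter `y` in the `α`-affinity
`∑ P ^ α (P_X ⊗ q) ^ (1 - α) = ∑_y affinityWeight P α y * q y ^ (1 - α)`. -/
noncomputable def affinityWeight (P : X × Y → ℝ) (α : ℝ) (y : Y) : ℝ :=
  ∑ x, if P (x, y) ≠ 0 then P (x, y) ^ α * marginalFst P x ^ (1 - α) else 0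

lemma affinityWeight_nonneg (hP : P ∈ stdSimplex ℝ (X × Y)) (α : ℝ) (y : Y) :
    0 ≤ affinityWeight P α y :=
  sum_nonneg fun x _ => by
    split_ifs
    · exact mul_nonneg (Real.rpow_nonneg (hP.1 _) _) (Real.rpow_nonneg (marginalFst_nonneg hP _) _)
    · exact le_rfl

open Classical in
lemma sum_affinityWeight (hP : P ∈ stdSimplex ℝ (X × Y)) (α : ℝ) {q : Y → ℝ} (hq : ∀ y, 0 ≤ q y) :
    ∑ y, affinityWeight P α y * q y ^ (1 - α) =
      ∑ z with P z ≠ 0, P z ^ α * (marginalFst P z.1 * q z.2) ^ (1 - α) := by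
  rw [sum_filter, Fintype.sum_prod_type_right]
  refine sum_congr rfl fun y _ => ?_
  rw [affinityWeight, sum_mul]
  refine sum_congr rfl fun x _ => ?_
  split_ifs
  · rw [Real.mul_rpow (marginalFst_nonneg hP _) (hq _), mul_assoc]
  · exact zero_mul _

/-- A single-letter bound `A` on the affinities bounds the overlaps of `P^{⊗ n}` with arbitrary, not
necessarily product, distributions `q` of words. The letter pairs outside the support of `P` are
removed, which matters for `α = 0`, where `0 ^ 0 = 1`. -/
lemma overlap_iid_le (hP : P ∈ stdSimplex ℝ (X × Y)) {α : ℝ} (hα : α ∈ Set.Ico (0 : ℝ) 1) {A : ℝ}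
    (hA : 0 ≤ A) (h : ∀ q ∈ stdSimplex ℝ Y, ∑ y, affinityWeight P α y * q y ^ (1 - α) ≤ A)
    (n : ℕ) {L : ℝ} (hL : 0 ≤ L) {q : (Fin n → Y) → ℝ} (hq : q ∈ stdSimplex ℝ (Fin n → Y)) :
    overlap (iid P n) L q ≤ L ^ (1 - α) * A ^ n := by
  classical
  have hβ : 0 < 1 - α := sub_pos.2 hα.2
  let φ : X → Y → ℝ := fun x y =>
    if P (x, y) ≠ 0 then P (x, y) ^ α * marginalFst P x ^ (1 - α) else 0
  have hφ : ∀ x y, 0 ≤ φ x y := fun x y => by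
    simp only [φ]
    split_ifs
    · exact mul_nonneg (Real.rpow_nonneg (hP.1 _) _) (Real.rpow_nonneg (marginalFst_nonneg hP _) _)
    · exact le_rfl
  have hterm : ∀ x y, min (iid P n (x, y)) (L * (marginalFst (iid P n) x * q y)) ≤
      (∏ i, φ (x i) (y i)) * (L ^ (1 - α) * q y ^ (1 - α)) := fun x y => by
    have hR : 0 ≤ L ^ (1 - α) * q y ^ (1 - α) :=
      mul_nonneg (Real.rpow_nonneg hL _) (Real.rpow_nonneg (hq.1 y) _)
    by_cases h0 : ∀ i, P (x i, y i) ≠ 0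
    · have hm : 0 ≤ ∏ i, marginalFst P (x i) := prod_nonneg fun i _ => marginalFst_nonneg hP _
      refine (min_le_rpow_mul_rpow ((iid_mem_stdSimplex hP n).1 _)
        (mul_nonneg hL (mul_nonneg (marginalFst_nonneg (iid_mem_stdSimplex hP n) x) (hq.1 y)))
        ⟨hα.1, hα.2.le⟩).trans_eq ?_
      have : ∀ i, φ (x i) (y i) = P (x i, y i) ^ α * marginalFst P (x i) ^ (1 - α) := fun i =>
        if_pos (h0 i)
      simp_rw [this, prod_mul_distrib]
      rw [Real.finsetProd_rpow _ _ fun i _ => hP.1 _,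
        Real.finsetProd_rpow _ _ fun i _ => marginalFst_nonneg hP _, marginalFst_iid,
        Real.mul_rpow hL (mul_nonneg hm (hq.1 y)), Real.mul_rpow hm (hq.1 y), iid]
      ring
    · push Not at h0
      obtain ⟨i, hi⟩ := h0
      refine (min_le_left _ _).trans ?_
      rw [iid, prod_eq_zero (mem_univ i) hi]
      exact mul_nonneg (prod_nonneg fun i _ => hφ _ _) hR
  calc overlap (iid P n) L q
      ≤ ∑ y : Fin n → Y, ∑ x : Fin n → X, (∏ i, φ (x i) (y i)) * (L ^ (1 - α) * q y ^ (1 - α)) := by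
        rw [overlap, Fintype.sum_prod_type_right]
        exact sum_le_sum fun y _ => sum_le_sum fun x _ => hterm x y
    _ = L ^ (1 - α) * ∑ y : Fin n → Y, (∏ i, affinityWeight P α (y i)) * q y ^ (1 - α) := by
        rw [mul_sum]
        refine sum_congr rfl fun y _ => ?_
        rw [← sum_mul, ← Fintype.prod_sum fun i x => φ x (y i)]
        simp only [affinityWeight, φ]
        ring
    _ ≤ L ^ (1 - α) * (A ^ n * (∑ y, q y) ^ (1 - α)) :=
        mul_le_mul_of_nonneg_left
          (sum_prod_mul_rpow_le (affinityWeight_nonneg hP α) hβ hA h n hq.1)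
          (Real.rpow_nonneg hL _)
    _ = _ := by rw [hq.2, Real.one_rpow, mul_one]

lemma sum_affinityWeight_le_of_le_renyiMutualInfo (hP : P ∈ stdSimplex ℝ (X × Y)) {α i : ℝ}
    (hα : α < 1) (hi : (i : EReal) ≤ renyiMutualInfo α P) {q : Y → ℝ} (hq : q ∈ stdSimplex ℝ Y) :
    ∑ y, affinityWeight P α y * q y ^ (1 - α) ≤ 2 ^ (-(1 - α) * i) := by
  have hβ : 0 < 1 - α := sub_pos.2 hα
  have h : (i : EReal) ≤ renyiDiv α P (fun z => marginalFst P z.1 * q z.2) :=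
    hi.trans (iInf₂_le q hq)
  rw [sum_affinityWeight hP α hq.1]
  by_cases hex : ∃ z, P z ≠ 0 ∧ marginalFst P z.1 * q z.2 ≠ 0
  · rw [renyiDiv, if_neg hα.ne, if_pos (Or.inl ⟨hα, hex⟩), EReal.coe_le_coe_iff] at h
    obtain ⟨z, hz, hz'⟩ := hex
    have hnn : ∀ z : X × Y, 0 ≤ P z ^ α * (marginalFst P z.1 * q z.2) ^ (1 - α) := fun z =>
      mul_nonneg (Real.rpow_nonneg (hP.1 _) _)
        (Real.rpow_nonneg (mul_nonneg (marginalFst_nonneg hP _) (hq.1 _)) _)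
    have hpos : 0 < ∑ z with P z ≠ 0, P z ^ α * (marginalFst P z.1 * q z.2) ^ (1 - α) := by
      refine sum_pos' (fun z _ => hnn z) ⟨z, by simpa using hz, mul_pos ?_ ?_⟩
      · exact Real.rpow_pos_of_pos ((hP.1 z).lt_of_ne' hz) _
      · exact Real.rpow_pos_of_pos
          ((mul_nonneg (marginalFst_nonneg hP _) (hq.1 _)).lt_of_ne' hz') _
    rw [← Real.logb_le_iff_le_rpow one_lt_two hpos]
    have h2 := mul_le_mul_of_nonneg_left h hβ.le
    rw [← mul_assoc, show (1 - α) * (1 / (α - 1)) = -1 by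
      rw [← neg_sub α 1, neg_mul, mul_one_div_cancel (sub_ne_zero.2 hα.ne)]] at h2
    linarith
  · push Not at hex
    rw [sum_eq_zero]
    · positivity
    · intro z hz
      rw [hex z (by simpa using hz), Real.zero_rpow hβ.ne', mul_zero]

end

/-! ### Chernoff lower bound -/

/-- The log-likelihood ratio; its junk values outside the common support of `p` and `Q` are always
multiplied by `commonPart p Q = 0`. -/
noncomputable def logRatio {Z : Type*} (p Q : Z → ℝ) (z : Z) : ℝ :=
  Real.log (p z / Q z)

open Classical in
/-- The restriction of `Q` to the support of `p`. -/
noncomputable def commonPart {Z : Type*} (p Q : Z → ℝ) (z : Z) : ℝ :=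
  if p z = 0 then 0 else Q z

lemma commonPart_nonneg {Z : Type*} {p Q : Z → ℝ} (hQ : ∀ z, 0 ≤ Q z) (z : Z) :
    0 ≤ commonPart p Q z := by
  unfold commonPart
  split_ifs
  exacts [le_rfl, hQ z]

section

variable {Z : Type*} [Fintype Z]

/-- The `α`-affinity `∑ p ^ α Q ^ (1 - α)`, used for `0 < α < 1` only. -/
noncomputable def affinity (p Q : Z → ℝ) (α : ℝ) : ℝ :=
  ∑ z, p z ^ α * Q z ^ (1 - α)

/-- On `(0, 1)` the affinity is a finite combination of exponentials in `α`. -/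
lemma affinity_eq_sum_exp {p Q : Z → ℝ} (hp : ∀ z, 0 ≤ p z) (hQ : ∀ z, 0 ≤ Q z) {α : ℝ}
    (hα : α ∈ Set.Ioo (0 : ℝ) 1) :
    affinity p Q α = ∑ z, commonPart p Q z * Real.exp (α * logRatio p Q z) := by
  refine sum_congr rfl fun z _ => ?_
  unfold commonPart
  split_ifs with h
  · rw [h, Real.zero_rpow hα.1.ne', zero_mul, zero_mul]
  · rcases (hQ z).eq_or_lt with h' | h'
    · rw [← h', Real.zero_rpow (sub_pos.2 hα.2).ne', mul_zero, zero_mul]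
    · have hpz : 0 < p z := (hp z).lt_of_ne' h
      rw [mul_comm α, logRatio, ← Real.rpow_def_of_pos (div_pos hpz h'), Real.div_rpow hpz.le h'.le,
        Real.rpow_sub h', Real.rpow_one]
      ring

lemma convexOn_affinity {p Q : Z → ℝ} (hp : ∀ z, 0 ≤ p z) (hQ : ∀ z, 0 ≤ Q z) :
    ConvexOn ℝ (Set.Ioo (0 : ℝ) 1) (affinity p Q) := by
  refine ConvexOn.congr (f := fun α => ∑ z, commonPart p Q z * Real.exp (α * logRatio p Q z)) ?_
    fun α hα => (affinity_eq_sum_exp hp hQ hα).symm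
  refine ⟨convex_Ioo 0 1, fun x _ y _ a b ha hb hab => ?_⟩
  simp only [smul_eq_mul]
  rw [mul_sum, mul_sum, ← sum_add_distrib]
  refine sum_le_sum fun z _ => ?_
  have h := mul_le_mul_of_nonneg_left (convexOn_exp.2 (Set.mem_univ (x * logRatio p Q z))
    (Set.mem_univ (y * logRatio p Q z)) ha hb hab) (commonPart_nonneg hQ (p := p) z)
  simp only [smul_eq_mul] at h
  calc _ = commonPart p Q z *
        Real.exp (a * (x * logRatio p Q z) + b * (y * logRatio p Q z)) := by ring_nf
    _ ≤ _ := h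
    _ = _ := by ring

lemma continuousOn_affinity {p Q : Z → ℝ} (hp : ∀ z, 0 ≤ p z) (hQ : ∀ z, 0 ≤ Q z) :
    ContinuousOn (affinity p Q) (Set.Ioo (0 : ℝ) 1) := by
  refine ContinuousOn.congr (f := fun α => ∑ z, commonPart p Q z * Real.exp (α * logRatio p Q z)) ?_
    fun α hα => affinity_eq_sum_exp hp hQ hα
  fun_prop

/-- The exponential tilting `t ∝ p ^ a Q ^ (1 - a)`, at the minimizer `a` over `[0, 1]` of the
affinity (continuously extended from the open interval). The first-order condition at `a` gives the
sign conditions on the mean of the log-likelihood ratio `ℓ`. -/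
lemma exists_tilting {p Q : Z → ℝ} (hp : ∀ z, 0 ≤ p z) (hQ : ∀ z, 0 ≤ Q z) {c : ℝ} (hc : 0 < c)
    (h : ∀ α ∈ Set.Ioo (0 : ℝ) 1, c ≤ affinity p Q α) :
    ∃ a ∈ Set.Icc (0 : ℝ) 1, ∃ g, c ≤ g ∧ ∃ t ∈ stdSimplex ℝ Z, ∃ ℓ : Z → ℝ,
      0 ≤ (1 - a) * ∑ z, t z * ℓ z ∧ 0 ≤ -a * ∑ z, t z * ℓ z ∧
      ∀ z, g * (t z * Real.exp ((1 - a) * ℓ z)) ≤ p z ∧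
        g * (t z * Real.exp (-a * ℓ z)) ≤ Q z := by
  set w := commonPart p Q
  set ℓ := logRatio p Q
  let G : ℝ → ℝ := fun s => ∑ z, w z * Real.exp (s * ℓ z)
  have hw : ∀ z, 0 ≤ w z := commonPart_nonneg hQ
  have hG : Continuous G := by fun_prop
  obtain ⟨a, ha, hmin⟩ := isCompact_Icc.exists_isMinOn (s := Set.Icc (0 : ℝ) 1)
    ⟨0, by simp⟩ hG.continuousOn
  have hcG : c ≤ G a := by
    have hcl : closure (Set.Ioo (0 : ℝ) 1) ⊆ {s | c ≤ G s} :=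
      closure_minimal (fun α hα => (h α hα).trans_eq (affinity_eq_sum_exp hp hQ hα))
        (isClosed_le continuous_const hG)
    rw [closure_Ioo zero_ne_one] at hcl
    exact hcl ha
  have hGa : 0 < G a := hc.trans_le hcG
  have hder : HasDerivAt G (∑ z, w z * (Real.exp (a * ℓ z) * ℓ z)) a := by
    refine HasDerivAt.fun_sum fun z _ => HasDerivAt.const_mul _ (HasDerivAt.exp ?_)
    simpa using (hasDerivAt_id a).mul_const (ℓ z)
  have hfirst : ∀ b ∈ Set.Icc (0 : ℝ) 1, 0 ≤ (b - a) * ∑ z, w z * (Real.exp (a * ℓ z) * ℓ z) := by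
    intro b hb
    have := hmin.localize.hasFDerivWithinAt_nonneg hder.hasFDerivAt.hasFDerivWithinAt
      (sub_mem_posTangentConeAt_of_segment_subset ((convex_Icc 0 1).segment_subset ha hb))
    simpa using this
  have hmean : ∑ z, w z * Real.exp (a * ℓ z) / G a * ℓ z =
      (∑ z, w z * (Real.exp (a * ℓ z) * ℓ z)) / G a := by
    rw [sum_div]
    exact sum_congr rfl fun z _ => by ring
  refine ⟨a, ha, G a, hcG, fun z => w z * Real.exp (a * ℓ z) / G a,
    ⟨fun z => by have := hw z; positivity, by rw [← sum_div]; exact div_self hGa.ne'⟩, ℓ, ?_, ?_,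
    fun z => ?_⟩
  · rw [hmean, ← mul_div_assoc]
    exact div_nonneg (hfirst 1 (by simp)) hGa.le
  · rw [hmean, ← mul_div_assoc]
    exact div_nonneg (by simpa using hfirst 0 (by simp)) hGa.le
  · have h1 : ∀ s, G a * (w z * Real.exp (a * ℓ z) / G a * Real.exp s) =
        w z * Real.exp (a * ℓ z + s) := fun s => by
      rw [Real.exp_add]
      field_simp
    rw [h1, h1, show a * ℓ z + (1 - a) * ℓ z = ℓ z by ring,
      show a * ℓ z + -a * ℓ z = 0 by ring, Real.exp_zero, mul_one]
    simp only [w, ℓ, commonPart, logRatio]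
    split_ifs with h0
    · simp [hp z, hQ z]
    · rcases (hQ z).eq_or_lt with h' | h'
      · simp [← h', hp z]
      · have hpz : 0 < p z := (hp z).lt_of_ne' h0
        rw [Real.exp_log (div_pos hpz h'), mul_div_cancel₀ _ h'.ne']
        exact ⟨le_rfl, le_rfl⟩

/-- The variance of a sum of `n` independent centred copies. -/
lemma sum_prod_mul_sq_sum {t : Z → ℝ} (ht : ∑ z, t z = 1) {h : Z → ℝ} (h0 : ∑ z, t z * h z = 0)
    (n : ℕ) :
    ∑ w : Fin n → Z, (∏ i, t (w i)) * (∑ i, h (w i)) ^ 2 = n * ∑ z, t z * h z ^ 2 := by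
  classical
  simp_rw [sq, sum_mul_sum, mul_sum]
  rw [sum_comm]
  simp_rw [sum_comm (s := (univ : Finset (Fin n → Z)))]
  have : ∀ i j : Fin n, ∑ w : Fin n → Z, (∏ k, t (w k)) * (h (w i) * h (w j)) =
      if i = j then ∑ z, t z * (h z * h z) else 0 := fun i j => by
    split_ifs with hij
    · subst hij
      exact sum_prod_mul_apply ht i fun z => h z * h z
    · rw [sum_prod_mul_apply_mul_apply ht hij, h0, zero_mul]
  simp_rw [this]
  simp [mul_sum]

/-- If all affinities of `p` and `Q` are at least `c`, then the overlap of the tensor powers decays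
no faster than `c ^ n`, up to a subexponential factor. Under the tilted measure the log-likelihood
ratio of a word is within `O(√n)` of its mean, and the sign conditions on the mean ensure that both
`p^{⊗ n}` and `Q^{⊗ n}` dominate the tilted measure there; Jensen's inequality for `exp` makes this
quantitative. -/
lemma exists_pow_mul_exp_le_sum_min {p Q : Z → ℝ} (hp : ∀ z, 0 ≤ p z) (hQ : ∀ z, 0 ≤ Q z) {c : ℝ}
    (hc : 0 < c) (h : ∀ α ∈ Set.Ioo (0 : ℝ) 1, c ≤ affinity p Q α) :
    ∃ C : ℝ, ∀ n : ℕ, 0 < n →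
      c ^ n * Real.exp (-(C * √n)) ≤ ∑ w : Fin n → Z, min (∏ i, p (w i)) (∏ i, Q (w i)) := by
  obtain ⟨a, ha, g, hg, t, ht, ℓ, h1, h2, hpQ⟩ := exists_tilting hp hQ hc h
  set μ := ∑ z, t z * ℓ z
  have hg0 : 0 ≤ g := hc.le.trans hg
  have hcen : ∑ z, t z * (ℓ z - μ) = 0 := by
    simp_rw [mul_sub, sum_sub_distrib, ← sum_mul, ht.2, one_mul]
    exact sub_self _
  set V := ∑ z, t z * (ℓ z - μ) ^ 2
  refine ⟨(1 + V) / 2, fun n hn => ?_⟩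
  have hsn : 0 < √(n : ℝ) := Real.sqrt_pos.2 (Nat.cast_pos.2 hn)
  have hT := prod_mem_stdSimplex ht n
  let D : (Fin n → Z) → ℝ := fun w => ∑ i, (ℓ (w i) - μ)
  have hD : ∀ w, ∑ i, ℓ (w i) = D w + n * μ := fun w => by
    simp [D, sum_sub_distrib]
  have hpow : ∀ (w : Fin n → Z) (b : ℝ), ∏ i, g * (t (w i) * Real.exp (b * ℓ (w i))) =
      g ^ n * ((∏ i, t (w i)) * Real.exp (b * ∑ i, ℓ (w i))) := fun w b => by
    rw [prod_mul_distrib, prod_mul_distrib, ← Real.exp_sum, mul_sum]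
    simp
  have hterm : ∀ w : Fin n → Z, g ^ n * ((∏ i, t (w i)) * Real.exp (-|D w|)) ≤
      min (∏ i, p (w i)) (∏ i, Q (w i)) := by
    intro w
    have hstep : ∀ b : ℝ, |b| ≤ 1 → 0 ≤ b * μ →
        g ^ n * ((∏ i, t (w i)) * Real.exp (-|D w|)) ≤
        ∏ i, g * (t (w i) * Real.exp (b * ℓ (w i))) := fun b hb hbμ => by
      rw [hpow]
      refine mul_le_mul_of_nonneg_left (mul_le_mul_of_nonneg_left (Real.exp_le_exp.2 ?_) (hT.1 w))
        (pow_nonneg hg0 n)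
      have h3 : |b * D w| ≤ |D w| := by
        rw [abs_mul]
        exact mul_le_of_le_one_left (abs_nonneg _) hb
      have h4 : 0 ≤ n * (b * μ) := mul_nonneg n.cast_nonneg hbμ
      rw [hD]
      linarith [neg_abs_le (b * D w)]
    have hnn : ∀ (b : ℝ) (z : Z), 0 ≤ g * (t z * Real.exp (b * ℓ z)) := fun b z =>
      mul_nonneg hg0 (mul_nonneg (ht.1 z) (Real.exp_nonneg _))
    refine le_min ((hstep (1 - a) ?_ h1).trans (prod_le_prod (fun i _ => hnn _ _)
      fun i _ => (hpQ _).1)) ((hstep (-a) ?_ h2).trans (prod_le_prod (fun i _ => hnn _ _)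
      fun i _ => (hpQ _).2))
    · exact abs_le.2 ⟨by linarith [ha.2], by linarith [ha.1]⟩
    · exact abs_le.2 ⟨by linarith [ha.2], by linarith [ha.1]⟩
  have habs : ∑ w : Fin n → Z, (∏ i, t (w i)) * |D w| ≤ (1 + V) / 2 * √n := by
    have hamgm : ∀ w, |D w| ≤ √n / 2 + D w ^ 2 / (2 * √n) := fun w => by
      have : √n / 2 + D w ^ 2 / (2 * √n) - |D w| = (√n - |D w|) ^ 2 / (2 * √n) := by
        rw [← sq_abs (D w)]
        field_simp
        ring
      have h5 : 0 ≤ (√n - |D w|) ^ 2 / (2 * √n) := by positivity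
      linarith
    calc ∑ w : Fin n → Z, (∏ i, t (w i)) * |D w|
        ≤ ∑ w : Fin n → Z, (∏ i, t (w i)) * (√n / 2 + D w ^ 2 / (2 * √n)) :=
          sum_le_sum fun w _ => mul_le_mul_of_nonneg_left (hamgm w) (hT.1 w)
      _ = (∑ w : Fin n → Z, ∏ i, t (w i)) * (√n / 2) +
          (∑ w : Fin n → Z, (∏ i, t (w i)) * D w ^ 2) / (2 * √n) := by
          rw [sum_mul, sum_div, ← sum_add_distrib]
          exact sum_congr rfl fun w _ => by ring
      _ = √n / 2 + (n * V) / (2 * √n) := by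
          rw [hT.2, one_mul, sum_prod_mul_sq_sum ht.2 hcen]
      _ = _ := by
          have h6 : (n : ℝ) = √n * √n := (Real.mul_self_sqrt n.cast_nonneg).symm
          rw [show (n : ℝ) * V / (2 * √n) = √n * √n * V / (2 * √n) by rw [← h6]]
          field_simp
  calc c ^ n * Real.exp (-((1 + V) / 2 * √n))
      ≤ g ^ n * Real.exp (∑ w : Fin n → Z, (∏ i, t (w i)) • -|D w|) := by
        refine mul_le_mul (pow_le_pow_left₀ hc.le hg n) (Real.exp_le_exp.2 ?_)
          (Real.exp_nonneg _) (pow_nonneg hg0 n)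
        simp_rw [smul_eq_mul, mul_neg, sum_neg_distrib]
        exact neg_le_neg habs
    _ ≤ g ^ n * ∑ w : Fin n → Z, (∏ i, t (w i)) • Real.exp (-|D w|) :=
        mul_le_mul_of_nonneg_left
          (convexOn_exp.map_sum_le (fun w _ => hT.1 w) hT.2 fun _ _ => Set.mem_univ _)
          (pow_nonneg hg0 n)
    _ ≤ _ := by
        rw [mul_sum]
        exact sum_le_sum fun w _ => hterm w

end

/-! ### Minimax -/

section

variable {X Y : Type*} [Fintype X] [Fintype Y] {p : X × Y → ℝ} {u : X → ℝ}

lemma continuous_affinity_prod (p : X × Y → ℝ) (u : X → ℝ) {α : ℝ} (hα : α ∈ Set.Ioo (0 : ℝ) 1) :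
    Continuous fun q : Y → ℝ => affinity p (fun z => u z.1 * q z.2) α := by
  refine continuous_finsetSum _ fun z _ => continuous_const.mul ?_
  exact Continuous.rpow_const (by fun_prop) fun _ => Or.inr (sub_pos.2 hα.2).le

lemma concaveOn_affinity_prod (hp : ∀ z, 0 ≤ p z) (hu : ∀ x, 0 ≤ u x) {α : ℝ}
    (hα : α ∈ Set.Ioo (0 : ℝ) 1) :
    ConcaveOn ℝ (stdSimplex ℝ Y) fun q => affinity p (fun z => u z.1 * q z.2) α := by
  refine ⟨convex_stdSimplex ℝ Y, fun q hq q' hq' a b ha hb hab => ?_⟩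
  simp only [smul_eq_mul, affinity]
  rw [mul_sum, mul_sum, ← sum_add_distrib]
  refine sum_le_sum fun z _ => ?_
  have h := mul_le_mul_of_nonneg_left
    ((Real.concaveOn_rpow (sub_pos.2 hα.2).le (sub_le_self 1 hα.1.le)).2
      (Set.mem_Ici.2 (mul_nonneg (hu z.1) (hq.1 z.2)))
      (Set.mem_Ici.2 (mul_nonneg (hu z.1) (hq'.1 z.2))) ha hb hab)
    (Real.rpow_nonneg (hp z) α)
  simp only [smul_eq_mul] at h
  calc _ = p z ^ α * (a * (u z.1 * q z.2) ^ (1 - α) + b * (u z.1 * q' z.2) ^ (1 - α)) := by ring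
    _ ≤ _ := h
    _ = _ := by
      congr 2
      simp only [Pi.add_apply, Pi.smul_apply, smul_eq_mul]
      ring

/-- The affinity `∑ p ^ α (u ⊗ q) ^ (1 - α)` is concave in `q` and convex in `α`, so if for each `α`
some `q` makes it exceed `c`, then one `q` works for all `α`. Sion's theorem provides such a `q` for
any finite set of `α`, and the simplex is compact. -/
lemma exists_forall_le_affinity_prod (hp : ∀ z, 0 ≤ p z) (hu : ∀ x, 0 ≤ u x) {c : ℝ}
    (h : ∀ α ∈ Set.Ioo (0 : ℝ) 1, ∃ q ∈ stdSimplex ℝ Y,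
      c < affinity p (fun z => u z.1 * q z.2) α) :
    ∃ q ∈ stdSimplex ℝ Y, ∀ α ∈ Set.Ioo (0 : ℝ) 1,
      c ≤ affinity p (fun z => u z.1 * q z.2) α := by
  have hne : (stdSimplex ℝ Y).Nonempty := by
    obtain ⟨q, hq, -⟩ := h (1 / 2) ⟨by norm_num, by norm_num⟩
    exact ⟨q, hq⟩
  have hQ : ∀ q ∈ stdSimplex ℝ Y, ∀ z : X × Y, 0 ≤ u z.1 * q z.2 := fun q hq z =>
    mul_nonneg (hu _) (hq.1 _)
  have hfin : ∀ s : Finset (Set.Ioo (0 : ℝ) 1), (stdSimplex ℝ Y ∩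
      ⋂ α ∈ s, {q : Y → ℝ | c ≤ affinity p (fun z => u z.1 * q z.2) α}).Nonempty := by
    intro s
    by_contra hs
    obtain ⟨α, hα, hlt⟩ := Sion.exists_lt_iInf_of_lt_iInf_of_finite
      (X := stdSimplex ℝ Y) (Y := Set.Ioo (0 : ℝ) 1)
      (f := fun q α => -affinity p (fun z => u z.1 * q z.2) α) hne (isCompact_stdSimplex ℝ Y)
      (fun α hα => (continuous_affinity_prod p u hα).neg.lowerSemicontinuous.lowerSemicontinuousOn _)
      (fun α hα => (concaveOn_affinity_prod hp hu hα).neg.quasiconvexOn) (convex_Ioo 0 1)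
      (fun q hq => (continuousOn_affinity hp (hQ q hq)).neg.upperSemicontinuousOn)
      (fun q hq => (convexOn_affinity hp (hQ q hq)).neg.quasiconcaveOn) (convex_stdSimplex ℝ Y)
      (s := Subtype.val '' (s : Set (Set.Ioo (0 : ℝ) 1))) (s.finite_toSet.image _) (by simp)
      (t := -c) (fun q hq => by
        by_contra hcon
        push Not at hcon
        refine hs ⟨q, hq, Set.mem_iInter₂.2 fun α hα => ?_⟩
        exact neg_le_neg_iff.1 (hcon α ⟨α, hα, rfl⟩))
    obtain ⟨q, hq, hlt'⟩ := h α hα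
    exact lt_asymm hlt' (neg_lt_neg_iff.1 (hlt q hq))
  obtain ⟨q, hq, hq'⟩ := (isCompact_stdSimplex ℝ Y).inter_iInter_nonempty
    (fun α : Set.Ioo (0 : ℝ) 1 => {q : Y → ℝ | c ≤ affinity p (fun z => u z.1 * q z.2) α})
    (fun α => isClosed_le continuous_const (continuous_affinity_prod p u α.2)) hfin
  exact ⟨q, hq, fun α hα => Set.mem_iInter.1 hq' ⟨α, hα⟩⟩

end

/-! ### The exponent -/

section

variable {X Y : Type*} [Fintype X] [Fintype Y] {P : X × Y → ℝ}

/-- The logarithm in the exponent is never taken at `0`. -/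
lemma one_sub_optError_pos (hP : P ∈ stdSimplex ℝ (X × Y)) {l : ℝ} (hl : 0 ≤ l) :
    0 < 1 - optError P l := by
  classical
  obtain ⟨z, hz⟩ : ∃ z, P z ≠ 0 := by
    by_contra! h
    simpa [h] using hP.2
  have hz' : 0 < P z := (hP.1 z).lt_of_ne' hz
  have hq := single_mem_stdSimplex ℝ z.2
  refine lt_of_lt_of_le ?_ (overlap_div_four_le_one_sub_optError hP hl hq)
  refine div_pos (sum_pos' (fun z' _ => le_min (hP.1 _) ?_) ⟨z, mem_univ z, lt_min hz' ?_⟩)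
    (by norm_num)
  · exact mul_nonneg (by positivity) (mul_nonneg (marginalFst_nonneg hP _) (hq.1 _))
  · rw [Pi.single_eq_same, mul_one]
    exact mul_pos (by positivity) (hz'.trans_le (le_marginalFst hP z))

lemma overlap_iid_prod (P : X × Y → ℝ) (q : Y → ℝ) (r : ℝ) (n : ℕ) :
    overlap (iid P n) (2 ^ (n * r)) (fun y => ∏ i, q (y i)) =
      ∑ w : Fin n → X × Y, min (∏ i, P (w i))
        (∏ i, 2 ^ r * marginalFst P (w i).1 * q (w i).2) := by
  rw [overlap, sum_words]
  refine sum_congr rfl fun w _ => ?_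
  rw [marginalFst_iid, prod_mul_distrib, prod_mul_distrib, prod_const, card_univ,
    Fintype.card_fin, mul_comm (n : ℝ) r, Real.rpow_mul_natCast zero_le_two, mul_assoc]
  rfl

/-- Achievability for words, with Bob's distribution a product. -/
lemma exists_pow_mul_exp_le_one_sub_optError (hP : P ∈ stdSimplex ℝ (X × Y)) {r : ℝ} (hr : 0 ≤ r)
    {q : Y → ℝ} (hq : q ∈ stdSimplex ℝ Y) {c : ℝ} (hc : 0 < c)
    (h : ∀ α ∈ Set.Ioo (0 : ℝ) 1,
      c ≤ affinity P (fun z => 2 ^ r * marginalFst P z.1 * q z.2) α) :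
    ∃ C : ℝ, ∀ n : ℕ, 0 < n →
      c ^ n * Real.exp (-(C * √n)) / 4 ≤ 1 - optError (iid P n) (n * r) := by
  obtain ⟨C, hC⟩ := exists_pow_mul_exp_le_sum_min hP.1 (fun z => mul_nonneg
    (mul_nonneg (by positivity) (marginalFst_nonneg hP z.1)) (hq.1 z.2)) hc h
  refine ⟨C, fun n hn => le_trans ?_ (overlap_div_four_le_one_sub_optError
    (iid_mem_stdSimplex hP n) (mul_nonneg n.cast_nonneg hr) (prod_mem_stdSimplex hq n))⟩
  rw [overlap_iid_prod]
  exact div_le_div_of_nonneg_right (hC n hn) (by norm_num)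

/-- An upper bound on `(1 - α) (I_α - r)` as a lower bound on an affinity; the factor `2 ^ r` absorbs
the rate. -/
lemma exists_lt_affinity (hP : P ∈ stdSimplex ℝ (X × Y)) {α : ℝ} (hα : α ∈ Set.Ioo (0 : ℝ) 1)
    {r e : ℝ} (h : ((1 - α : ℝ) : EReal) * (renyiMutualInfo α P - (r : EReal)) < e) :
    ∃ q ∈ stdSimplex ℝ Y,
      2 ^ (-e) < affinity P (fun z => 2 ^ r * marginalFst P z.1 * q z.2) α := by
  classical
  have hβ : 0 < 1 - α := sub_pos.2 hα.2
  have hI : renyiMutualInfo α P < ((e / (1 - α) + r : ℝ) : EReal) := by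
    by_contra! hcon
    refine h.not_ge ?_
    calc (e : EReal) = ((1 - α : ℝ) : EReal) * (((e / (1 - α) + r : ℝ) : EReal) - (r : EReal)) := by
          rw [← EReal.coe_sub, ← EReal.coe_mul, add_sub_cancel_right, mul_div_cancel₀ _ hβ.ne']
      _ ≤ _ := mul_le_mul_of_nonneg_left (EReal.sub_le_sub hcon le_rfl)
          (EReal.coe_nonneg.2 hβ.le)
  obtain ⟨q, hq, hD⟩ : ∃ q ∈ stdSimplex ℝ Y, renyiDiv α P (fun z => marginalFst P z.1 * q z.2) <
      ((e / (1 - α) + r : ℝ) : EReal) := by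
    simpa [renyiMutualInfo, iInf_lt_iff] using hI
  refine ⟨q, hq, ?_⟩
  have hex : ∃ z, P z ≠ 0 ∧ marginalFst P z.1 * q z.2 ≠ 0 := by
    by_contra hcon
    rw [renyiDiv, if_neg hα.2.ne, if_neg (by
      rintro (h | h)
      · exact hcon h.2
      · exact hα.2.not_gt h.1)] at hD
    exact not_top_lt hD
  rw [renyiDiv, if_neg hα.2.ne, if_pos (Or.inl ⟨hα.2, hex⟩), EReal.coe_lt_coe_iff] at hD
  have hnn : ∀ z : X × Y, 0 ≤ marginalFst P z.1 * q z.2 := fun z =>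
    mul_nonneg (marginalFst_nonneg hP _) (hq.1 _)
  set S := ∑ z with P z ≠ 0, P z ^ α * (marginalFst P z.1 * q z.2) ^ (1 - α)
  have hS : affinity P (fun z => 2 ^ r * marginalFst P z.1 * q z.2) α =
      2 ^ (r * (1 - α)) * S := by
    simp only [S]
    rw [sum_filter, mul_sum]
    refine sum_congr rfl fun z _ => ?_
    split_ifs with hz
    · simp only
      rw [mul_assoc, Real.mul_rpow (by positivity) (hnn z), ← Real.rpow_mul zero_le_two]
      ring
    · rw [not_not.1 hz, Real.zero_rpow hα.1.ne', zero_mul, mul_zero]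
  have hSpos : 0 < S := by
    obtain ⟨z, hz, hz'⟩ := hex
    refine sum_pos' (fun z _ => mul_nonneg (Real.rpow_nonneg (hP.1 _) _)
      (Real.rpow_nonneg (hnn z) _)) ⟨z, by simpa using hz, mul_pos ?_ ?_⟩
    · exact Real.rpow_pos_of_pos ((hP.1 z).lt_of_ne' hz) _
    · exact Real.rpow_pos_of_pos ((hnn z).lt_of_ne' hz') _
  have hlog : -e - r * (1 - α) < Real.logb 2 S := by
    have h2 := mul_lt_mul_of_pos_left hD hβ
    rw [← mul_assoc, show (1 - α) * (1 / (α - 1)) = -1 by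
      rw [← neg_sub α 1, neg_mul, mul_one_div_cancel (sub_ne_zero.2 hα.2.ne)], mul_add,
      mul_div_cancel₀ _ hβ.ne'] at h2
    linarith
  rw [hS]
  calc (2 : ℝ) ^ (-e) = 2 ^ (r * (1 - α)) * 2 ^ (-e - r * (1 - α)) := by
        rw [← Real.rpow_add zero_lt_two]
        congr 1
        ring
    _ < _ := mul_lt_mul_of_pos_left ((Real.lt_logb_iff_rpow_lt one_lt_two hSpos).1 hlog)
        (by positivity)

/-- This settles `α = 1`, where `(1 - α) (I_α - r)` vanishes. -/
lemma exponent_nonneg (hP : P ∈ stdSimplex ℝ (X × Y)) {r : ℝ} (hr : 0 ≤ r) (n : ℕ) :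
    0 ≤ (-1 / (n : ℝ)) * Real.logb 2 (1 - optError (iid P n) (n * r)) := by
  refine mul_nonneg_of_nonpos_of_nonpos (div_nonpos_of_nonpos_of_nonneg (by norm_num)
    n.cast_nonneg) (Real.logb_nonpos one_lt_two (one_sub_optError_pos (iid_mem_stdSimplex hP n)
      (mul_nonneg n.cast_nonneg hr)).le ?_)
  linarith [optError_nonneg (P := iid P n) (l := n * r)]

/-- The converse for words of every length. Quantifying over reals `i ≤ I_α` covers infinite values of
`I_α`. -/
lemma mul_sub_le_exponent (hP : P ∈ stdSimplex ℝ (X × Y)) {r : ℝ} (hr : 0 ≤ r) {α : ℝ}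
    (hα : α ∈ Set.Ico (0 : ℝ) 1) {i : ℝ} (hi : (i : EReal) ≤ renyiMutualInfo α P) {n : ℕ}
    (hn : 0 < n) :
    (1 - α) * (i - r) ≤ (-1 / (n : ℝ)) * Real.logb 2 (1 - optError (iid P n) (n * r)) := by
  have hn' : (0 : ℝ) < n := Nat.cast_pos.2 hn
  have hl : 0 ≤ n * r := mul_nonneg hn'.le hr
  have hPn := iid_mem_stdSimplex hP n
  have h : 1 - optError (iid P n) (n * r) ≤ 2 ^ (n * ((1 - α) * (r - i))) := by
    refine (one_sub_optError_le hPn hl fun q hq => overlap_iid_le hP hα (by positivity)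
      (fun q hq => sum_affinityWeight_le_of_le_renyiMutualInfo hP hα.2 hi hq) n
      (by positivity) hq).trans_eq ?_
    rw [← Real.rpow_mul_natCast zero_le_two, ← Real.rpow_mul zero_le_two,
      ← Real.rpow_add zero_lt_two]
    congr 1
    ring
  rw [← Real.logb_le_iff_le_rpow one_lt_two (one_sub_optError_pos hPn hl)] at h
  rw [neg_div, neg_mul, one_div_mul_eq_div, le_neg, div_le_iff₀ hn']
  linarith

lemma eventually_lt_exponent (hP : P ∈ stdSimplex ℝ (X × Y)) {r : ℝ} (hr : 0 ≤ r) {a : EReal}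
    (ha : a < ⨆ α ∈ Set.Icc (0 : ℝ) 1,
      ((1 - α : ℝ) : EReal) * (renyiMutualInfo α P - (r : EReal))) :
    ∀ᶠ n : ℕ in atTop,
      a < ((((-1 / (n : ℝ)) * Real.logb 2 (1 - optError (iid P n) (n * r)) : ℝ)) : EReal) := by
  obtain ⟨α, ha⟩ := lt_iSup_iff.1 ha
  obtain ⟨hα, ha⟩ := lt_iSup_iff.1 ha
  rcases hα.2.eq_or_lt with rfl | hα1
  · rw [sub_self, EReal.coe_zero, zero_mul] at ha
    exact Eventually.of_forall fun n =>
      ha.trans_le (EReal.coe_nonneg.2 (exponent_nonneg hP hr n))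
  · have hβ : 0 < 1 - α := sub_pos.2 hα1
    obtain ⟨i, hi, hai⟩ : ∃ i : ℝ, (i : EReal) ≤ renyiMutualInfo α P ∧
        a < (((1 - α) * (i - r) : ℝ) : EReal) := by
      generalize renyiMutualInfo α P = I at ha
      induction I with
      | bot =>
        rw [EReal.bot_sub, EReal.coe_mul_bot_of_pos hβ] at ha
        exact absurd ha not_lt_bot
      | coe i => exact ⟨i, le_rfl, by exact_mod_cast ha⟩
      | top =>
        obtain ⟨x, hax, -⟩ := EReal.lt_iff_exists_real_btwn.1
          (ha.trans_le le_top)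
        refine ⟨x / (1 - α) + r, le_top, ?_⟩
        rwa [add_sub_cancel_right, mul_div_cancel₀ _ hβ.ne']
    filter_upwards [eventually_gt_atTop 0] with n hn
    exact hai.trans_le (EReal.coe_le_coe_iff.2 (mul_sub_le_exponent hP hr ⟨hα.1, hα1⟩ hi hn))

lemma eventually_exponent_lt (hP : P ∈ stdSimplex ℝ (X × Y)) {r : ℝ} (hr : 0 ≤ r) {b : EReal}
    (hb : (⨆ α ∈ Set.Icc (0 : ℝ) 1,
      ((1 - α : ℝ) : EReal) * (renyiMutualInfo α P - (r : EReal))) < b) :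
    ∀ᶠ n : ℕ in atTop,
      ((((-1 / (n : ℝ)) * Real.logb 2 (1 - optError (iid P n) (n * r)) : ℝ)) : EReal) < b := by
  obtain ⟨d, hbd, hdb⟩ := EReal.lt_iff_exists_real_btwn.1 hb
  obtain ⟨e, hbe, hed⟩ := EReal.lt_iff_exists_real_btwn.1 hbd
  obtain ⟨q, hq, hq'⟩ := exists_forall_le_affinity_prod (p := P)
    (u := fun x => 2 ^ r * marginalFst P x) hP.1
    (fun x => mul_nonneg (by positivity) (marginalFst_nonneg hP x)) fun α hα =>
      exists_lt_affinity hP hα ((le_iSup₂ (f := fun (α : ℝ) (_ : α ∈ Set.Icc (0 : ℝ) 1) =>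
        ((1 - α : ℝ) : EReal) * (renyiMutualInfo α P - (r : EReal))) α
          (Set.Ioo_subset_Icc_self hα)).trans_lt hbe)
  obtain ⟨C, hC⟩ := exists_pow_mul_exp_le_one_sub_optError hP hr hq
    (Real.rpow_pos_of_pos zero_lt_two (-e)) hq'
  have hlim : Tendsto (fun n : ℕ => e + C / Real.log 2 * (√(n : ℝ))⁻¹ + 2 * (n : ℝ)⁻¹) atTop
      (𝓝 e) := by
    have h1 : Tendsto (fun n : ℕ => (√(n : ℝ))⁻¹) atTop (𝓝 0) :=
      (Real.tendsto_sqrt_atTop.comp tendsto_natCast_atTop_atTop).inv_tendsto_atTop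
    have h2 : Tendsto (fun n : ℕ => (n : ℝ)⁻¹) atTop (𝓝 0) :=
      tendsto_natCast_atTop_atTop.inv_tendsto_atTop
    simpa using ((h1.const_mul (C / Real.log 2)).const_add e).add (h2.const_mul 2)
  filter_upwards [hlim.eventually_lt_const (EReal.coe_lt_coe_iff.1 hed), eventually_gt_atTop 0]
    with n hnd hn
  refine lt_trans (EReal.coe_lt_coe_iff.2 (lt_of_le_of_lt ?_ hnd)) hdb
  have hn' : (0 : ℝ) < n := Nat.cast_pos.2 hn
  have hlog := Real.logb_le_logb_of_le one_lt_two (by positivity) (hC n hn)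
  have h4 : Real.logb 2 4 = 2 := by
    rw [show (4 : ℝ) = 2 ^ (2 : ℝ) by norm_num, Real.logb_rpow zero_lt_two (by norm_num)]
  rw [Real.logb_div (by positivity) (by norm_num), Real.logb_mul (by positivity) (by positivity),
    Real.logb_pow, Real.logb_rpow zero_lt_two (by norm_num), h4, Real.logb, Real.log_exp] at hlog
  have hsq : √(n : ℝ) / n = (√(n : ℝ))⁻¹ := Real.sqrt_div_self
  calc -1 / (n : ℝ) * Real.logb 2 (1 - optError (iid P n) (n * r))
      ≤ -1 / (n : ℝ) * (n * -e + -(C * √n) / Real.log 2 - 2) :=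
        mul_le_mul_of_nonpos_left hlog
          (div_nonpos_of_nonpos_of_nonneg (by norm_num) hn'.le)
    _ = e + C / Real.log 2 * (√(n : ℝ) / n) + 2 * (n : ℝ)⁻¹ := by
        field_simp
        ring
    _ = _ := by rw [hsq]

end

end ClassicalSplitting

theorem mainTheorem6 {X Y : Type*} [Fintype X] [Fintype Y]
    (P : X × Y → ℝ) (hP : P ∈ stdSimplex ℝ (X × Y)) (r : ℝ) (hr : 0 ≤ r) :
    Filter.Tendsto
      (fun n : ℕ =>
        (((-1 / (n : ℝ)) *
          Real.logb 2 (1 - ClassicalSplitting.optError (ClassicalSplitting.iid P n) (n * r)) : ℝ)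
          : EReal))
      Filter.atTop
      (𝓝 (⨆ α ∈ Set.Icc (0 : ℝ) 1,
        ((1 - α : ℝ) : EReal) * (ClassicalSplitting.renyiMutualInfo α P - (r : EReal)))) :=
  tendsto_order.2 ⟨fun _ ha => ClassicalSplitting.eventually_lt_exponent hP hr ha,
    fun _ hb => ClassicalSplitting.eventually_exponent_lt hP hr hb⟩
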